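/- Graphs are finite multigraphs (loops and multiple edges allowed, every edge has its ends glued to vertices). A graph has trivial automorphism group if the only pair consisting of a permutation of its vertices and a permutation of its edges that preserves incidence is the identity. A ribbon graph of $G$ is obtained from a disk for every vertex and a band for every edge, glued according to a cyclic order of the half-edges at every vertex, each band possibly carrying a half-twist; its faces are the disks glued to the boundary circles of this surface. It is called oriented if the surface is orientable. Two ribbon graphs of $G$ are equivalent if there is a homeomorphism (not necessarily preserving orientations) of the closed surfaces that induces an isomorphism of the graphs, and they are distinct if they are not equivalent. A partial $n$-face coloring of a ribbon graph of a trivalent graph assigns one of $n$ colors to every face such that at every vertex two or three distinct colors occur among the incident faces. For a ribbon graph $\Gamma$ of a trivalent graph $G=(V,E)$ and $\nu\in\{0,1\}^{V}$ let $k_\nu$ be the number of circles of the vertex state $\Gamma_\nu$, which is obtained from the boundary circles of the surface by letting, at every vertex $v$ with $\nu_v=1$, the two boundary lines of each of the three bands cross each other next to the disk of $v$. The vertex polynomial of $\Gamma$ is $V(\Gamma,n)=\sum_{\nu\in\{0,1\}^V}(-1)^{|\nu|}n^{k_\nu}$, where $|\nu|=\sum_v\nu_v$; $\Gamma$ is nonnegative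 if $V(\Gamma,n)\ge 0$ for all large $n\in\mathbb N$. The vertex polynomial $V(G,n)$ of a connected trivalent graph $G$ is $V(\Gamma,n)$ for any nonnegative oriented ribbon graph $\Gamma$ of $G$; it does not depend on the choice of $\Gamma$. Theorem. Let $\Gamma$ be a nonnegative oriented ribbon graph of a connected trivalent graph $G$ with at least one vertex and with trivial automorphism group. Then for every $n\in\mathbb N$ $$V(G,n)=2\left(\sum_{\Gamma'\ \mathrm{even}}\#\{\text{partial } n\text{-face colorings of }\Gamma'\}-\sum_{\Gamma'\ \mathrm{odd}}\#\{\text{partial } n\text{-face colorings of }\Gamma'\}\right),$$ where $\Gamma'$ runs over the distinct oriented ribbon graphs of $G$ that are even, respectively odd, with respect to $\Gamma$, i.e. that can be made equivalent to $\Gamma$ by inserting an even, respectively odd, number of half-twists into their bands. -/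

import Mathlib

open Polynomial

/-- A multigraph, with loops and multiple edges allowed: every edge `e` is an interval whose two
ends `(e, false)` and `(e, true)` are glued to the vertices `endpt e false` and `endpt e true`. -/
structure Multigraph (V : Type*) (E : Type*) where
  /-- the vertex to which a given end of an edge is glued -/
  endpt : E → Bool → V

namespace Multigraph

variable {V : Type*} {E : Type*}

/-- The vertex at a half-edge. The half-edges of the graph are the pairs `(e, b)`; a loop
contributes two half-edges to its vertex. -/
def vert (G : Multigraph V E) (h : E × Bool) : V := G.endpt h.1 h.2

/-- The other half of the same edge. -/
def opp (h : E × Bool) : E × Bool := (h.1, !h.2)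

/-- Every vertex has exactly three half-edges. -/
def IsTrivalent (G : Multigraph V E) : Prop :=
  ∀ v, Nat.card {h : E × Bool // G.vert h = v} = 3

/-- The graph is connected and has a vertex. -/
def IsConnected (G : Multigraph V E) : Prop :=
  (SimpleGraph.fromRel fun u v => ∃ h, G.vert h = u ∧ G.vert (opp h) = v).Connected

/-- An automorphism: a permutation of the vertices and one of the edges that preserve incidence. -/
def IsAutomorphism (G : Multigraph V E) (φ : Equiv.Perm V) (ψ : Equiv.Perm E) : Prop :=
  ∀ e, s(G.endpt (ψ e) false, G.endpt (ψ e) true) =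
    s(φ (G.endpt e false), φ (G.endpt e true))

/-- The only automorphism is the identity. -/
def HasTrivialAutomorphismGroup (G : Multigraph V E) : Prop :=
  ∀ φ ψ, G.IsAutomorphism φ ψ → φ = 1 ∧ ψ = 1

end Multigraph

/-- A ribbon graph of `G`, given as a signed rotation system: a cyclic order `rot` of the
half-edges around every vertex disc, and for every edge the information whether its band carries
a half-twist (`twist e = true`, a negative edge). -/
structure RibbonGraph {V : Type*} {E : Type*} (G : Multigraph V E) where
  /-- the next half-edge around the same vertex, in the positive sense of the vertex disc -/
  rot : Equiv.Perm (E × Bool)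
  vert_rot : ∀ h, G.vert (rot h) = G.vert h
  sameCycle_rot : ∀ h h', G.vert h = G.vert h' → rot.SameCycle h h'
  /-- whether the band of an edge has a half-twist -/
  twist : E → Bool

namespace RibbonGraph

open Multigraph

variable {V : Type*} {E : Type*} {G : Multigraph V E}

/-! Points on the boundary of the bands: the pair `(h, b)` is the side of the band of `h`, at the
vertex end of `h`, that faces the next half-edge `rot h` (if `b = false`) or the previous one
`rot⁻¹ h` (if `b = true`). -/

/-- The side of a band, followed to the other end of the band. Seen from the two ends of an
untwisted band, the same boundary line lies on opposite sides; a half-twist exchanges the sides. -/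
def strand (Γ : RibbonGraph G) (x : (E × Bool) × Bool) : (E × Bool) × Bool :=
  (opp x.1, !(x.2 ^^ Γ.twist x.1.1))

/-- The boundary of the vertex disc joins the side of `h` that faces `rot h` to the side of `rot h`
that faces `h`. -/
def corner (Γ : RibbonGraph G) : (E × Bool) × Bool → (E × Bool) × Bool
  | (h, false) => (Γ.rot h, true)
  | (h, true) => (Γ.rot⁻¹ h, false)

/-- The arcs at the vertices of the vertex state `ν`. A vertex 0-smoothing (`ν v = false`) consists
of the three arcs along the corners; in a vertex 1-smoothing (`ν v = true`) the two boundary lines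
of each of the three bands at `v` cross each other before they are joined along the corners. -/
def arc (Γ : RibbonGraph G) (ν : V → Bool) (x : (E × Bool) × Bool) : (E × Bool) × Bool :=
  if ν (G.vert x.1) = true then
    ((Γ.corner (x.1, !x.2)).1, !(Γ.corner (x.1, !x.2)).2)
  else Γ.corner x

/-- The circles of the vertex state `ν`: the closed curves composed of the boundary lines of the
bands and the arcs of the smoothings. -/
def StateCircle (Γ : RibbonGraph G) (ν : V → Bool) : Type _ :=
  Quot fun x y : (E × Bool) × Bool => y = Γ.strand x ∨ y = Γ.arc ν x

/-- The faces, i.e. the boundary circles of the surface: those of the all-zero state. -/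
def Face (Γ : RibbonGraph G) : Type _ := Γ.StateCircle fun _ => false

/-- The face that contains a given side of a band. -/
def face (Γ : RibbonGraph G) (x : (E × Bool) × Bool) : Γ.Face := Quot.mk _ x

/-- The vertex polynomial of a ribbon graph. Expanding every vertex as (0-smoothing) minus
(1-smoothing) and giving every circle the value `X` yields this sum over all states. -/
noncomputable def vertexPolynomial [Fintype V] [DecidableEq V] (Γ : RibbonGraph G) : ℤ[X] :=
  ∑ ν : V → Bool, (-1) ^ (Finset.univ.filter fun v => ν v = true).card *
    X ^ Nat.card (Γ.StateCircle ν)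

/-- The surface is orientable: the orientations of the vertex discs can be chosen (`s v = true`
means that the one at `v` is reversed) such that every band respects them. -/
def IsOrientable (Γ : RibbonGraph G) : Prop :=
  ∃ s : V → Bool, ∀ e, Γ.twist e = (s (G.endpt e false) ^^ s (G.endpt e true))

/-- The vertex polynomial is nonnegative at all large natural numbers. -/
def IsNonnegative [Fintype V] [DecidableEq V] (Γ : RibbonGraph G) : Prop :=
  ∀ᶠ n : ℕ in Filter.atTop, 0 ≤ Γ.vertexPolynomial.eval (n : ℤ)

/-- Equivalence of ribbon graphs, i.e. a homeomorphism of the closed surfaces that induces an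
isomorphism of the graphs, in terms of signed rotation systems: an isomorphism of graphs, given by
`φ` on vertices and `α` on half-edges, such that the homeomorphism preserves (`s v = false`) or
reverses (`s v = true`) the orientation of the disc of `v`. -/
def Equivalent (Γ₁ Γ₂ : RibbonGraph G) : Prop :=
  ∃ (φ : Equiv.Perm V) (α : Equiv.Perm (E × Bool)) (s : V → Bool),
    (∀ h, G.vert (α h) = φ (G.vert h)) ∧
    (∀ h, α (opp h) = opp (α h)) ∧
    (∀ h, s (G.vert h) = false → α (Γ₁.rot h) = Γ₂.rot (α h)) ∧
    (∀ h, s (G.vert h) = true → α (Γ₁.rot h) = Γ₂.rot⁻¹ (α h)) ∧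
    ∀ h, Γ₂.twist (α h).1 = (Γ₁.twist h.1 ^^ (s (G.vert h) ^^ s (G.vert (opp h))))

/-- Insert `k e` half-twists into the band of every edge `e`. -/
def insertHalfTwists (Γ : RibbonGraph G) (k : E → ℕ) : RibbonGraph G :=
  { Γ with twist := fun e => Γ.twist e ^^ (k e).bodd }

/-- `Γ'` can be made equivalent to `Γ` by inserting an even number of half-twists. -/
def IsEvenWithRespectTo [Fintype E] (Γ' Γ : RibbonGraph G) : Prop :=
  ∃ k : E → ℕ, Even (∑ e, k e) ∧ (Γ'.insertHalfTwists k).Equivalent Γ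

/-- `Γ'` can be made equivalent to `Γ` by inserting an odd number of half-twists. -/
def IsOddWithRespectTo [Fintype E] (Γ' Γ : RibbonGraph G) : Prop :=
  ∃ k : E → ℕ, Odd (∑ e, k e) ∧ (Γ'.insertHalfTwists k).Equivalent Γ

/-- The colors of the faces incident to the vertex `v`. -/
def colorsAt (Γ : RibbonGraph G) {n : ℕ} (c : Γ.Face → Fin n) (v : V) : Set (Fin n) :=
  {k | ∃ x : (E × Bool) × Bool, G.vert x.1 = v ∧ c (Γ.face x) = k}

/-- Partial `n`-face colorings: at every vertex there are three distinct colors (the coloring is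
proper there) or exactly two colors (it is partial there) among the incident faces. -/
def IsPartialFaceColoring (Γ : RibbonGraph G) {n : ℕ} (c : Γ.Face → Fin n) : Prop :=
  ∀ v, (Γ.colorsAt c v).ncard = 3 ∨ (Γ.colorsAt c v).ncard = 2

/-- The number of partial `n`-face colorings. -/
noncomputable def numPartialFaceColorings (Γ : RibbonGraph G) (n : ℕ) : ℕ :=
  Nat.card {c : Γ.Face → Fin n // Γ.IsPartialFaceColoring c}

theorem perm_apply_inv {A : Type*} (σ : Equiv.Perm A) (x : A) : σ (σ⁻¹ x) = x :=
  σ.apply_symm_apply x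

theorem vert_rot_inv (Γ : RibbonGraph G) (h : E × Bool) : G.vert (Γ.rot⁻¹ h) = G.vert h := by
  have := Γ.vert_rot (Γ.rot⁻¹ h)
  simpa using this.symm

theorem Equivalent.refl (Γ : RibbonGraph G) : Γ.Equivalent Γ :=
  ⟨1, 1, fun _ => false, by simp, by simp, by simp, by simp, by simp⟩

theorem Equivalent.symm {Γ₁ Γ₂ : RibbonGraph G} (H : Γ₁.Equivalent Γ₂) : Γ₂.Equivalent Γ₁ := by
  obtain ⟨φ, α, s, h1, h2, h3, h4, h5⟩ := H
  have hv : ∀ h, φ⁻¹ (G.vert h) = G.vert (α⁻¹ h) := by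
    intro h
    have := h1 (α⁻¹ h)
    simp only [perm_apply_inv] at this
    rw [this]; simp
  have ho : ∀ h, α⁻¹ (opp h) = opp (α⁻¹ h) := by
    intro h
    apply α.injective
    rw [h2]; simp
  refine ⟨φ⁻¹, α⁻¹, fun v => s (φ⁻¹ v), fun h => (hv h).symm, ho, ?_, ?_, ?_⟩
  · intro h hs
    beta_reduce at hs
    rw [hv] at hs
    apply α.injective
    rw [h3 _ hs]; simp
  · intro h hs
    beta_reduce at hs
    rw [hv] at hs
    have hs' : s (G.vert (Γ₁.rot⁻¹ (α⁻¹ h))) = true := by rw [vert_rot_inv]; exact hs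
    have := h4 _ hs'
    simp only [perm_apply_inv] at this
    apply α.injective
    have h6 : Γ₂.rot h = α (Γ₁.rot⁻¹ (α⁻¹ h)) := by
      have h7 := congrArg Γ₂.rot this
      rwa [perm_apply_inv] at h7
    rw [← h6]; simp
  · intro h
    have := h5 (α⁻¹ h)
    simp only [perm_apply_inv] at this
    simp only [hv, ho]
    rw [this]
    generalize s (G.vert (α⁻¹ h)) = a
    generalize s (G.vert (opp (α⁻¹ h))) = b
    cases Γ₁.twist (α⁻¹ h).1 <;> cases a <;> cases b <;> rfl

theorem Equivalent.trans {Γ₁ Γ₂ Γ₃ : RibbonGraph G} (H : Γ₁.Equivalent Γ₂)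
    (K : Γ₂.Equivalent Γ₃) : Γ₁.Equivalent Γ₃ := by
  obtain ⟨φ, α, s, h1, h2, h3, h4, h5⟩ := H
  obtain ⟨ψ, β, t, k1, k2, k3, k4, k5⟩ := K
  have key : ∀ h, t (G.vert (α h)) = true → β (Γ₂.rot⁻¹ (α h)) = Γ₃.rot (β (α h)) := by
    intro h ht
    have ht' : t (G.vert (Γ₂.rot⁻¹ (α h))) = true := by rw [vert_rot_inv]; exact ht
    have := k4 _ ht'
    simp only [perm_apply_inv] at this
    rw [this]; simp
  have key' : ∀ h, t (G.vert (α h)) = false → β (Γ₂.rot⁻¹ (α h)) = Γ₃.rot⁻¹ (β (α h)) := by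
    intro h ht
    have ht' : t (G.vert (Γ₂.rot⁻¹ (α h))) = false := by rw [vert_rot_inv]; exact ht
    have := k3 _ ht'
    simp only [perm_apply_inv] at this
    rw [this]; simp
  refine ⟨ψ * φ, β * α, fun v => s v ^^ t (φ v), ?_, ?_, ?_, ?_, ?_⟩
  · intro h; simp [h1, k1]
  · intro h; simp [h2, k2]
  · intro h hs
    beta_reduce at hs
    simp only [Equiv.Perm.mul_apply]
    rw [← h1] at hs
    cases hsv : s (G.vert h) <;> rw [hsv] at hs
    · rw [h3 _ hsv, k3 _ (by simpa using hs)]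
    · rw [h4 _ hsv, key _ (by simpa using hs)]
  · intro h hs
    beta_reduce at hs
    simp only [Equiv.Perm.mul_apply]
    rw [← h1] at hs
    cases hsv : s (G.vert h) <;> rw [hsv] at hs
    · rw [h3 _ hsv, k4 _ (by simpa using hs)]
    · rw [h4 _ hsv, key' _ (by simpa using hs)]
  · intro h
    simp only [Equiv.Perm.mul_apply]
    rw [k5, h5, ← h2, h1, h1]
    generalize s (G.vert h) = a
    generalize s (G.vert (opp h)) = b
    generalize t (φ (G.vert h)) = c
    generalize t (φ (G.vert (opp h))) = d
    cases Γ₁.twist h.1 <;> cases a <;> cases b <;> cases c <;> cases d <;> rfl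

/-- Equivalence of ribbon graphs of `G`. -/
instance setoid (G : Multigraph V E) : Setoid (RibbonGraph G) where
  r := Equivalent
  iseqv := ⟨Equivalent.refl, Equivalent.symm, Equivalent.trans⟩

theorem Equivalent.numPartialFaceColorings_le {Γ₁ Γ₂ : RibbonGraph G} [Finite E]
    (H : Γ₁.Equivalent Γ₂) (n : ℕ) :
    Γ₂.numPartialFaceColorings n ≤ Γ₁.numPartialFaceColorings n := by
  obtain ⟨φ, α, s, h1, h2, h3, h4, h5⟩ := H
  let f : (E × Bool) × Bool → (E × Bool) × Bool := fun x => (α x.1, x.2 ^^ s (G.vert x.1))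
  have hstrand : ∀ x, f (Γ₁.strand x) = Γ₂.strand (f x) := by
    rintro ⟨h, b⟩
    simp only [f, strand, h2, h5, Prod.mk.injEq, true_and]
    generalize s (G.vert h) = a
    generalize s (G.vert (opp h)) = c
    cases Γ₁.twist h.1 <;> cases a <;> cases b <;> cases c <;> rfl
  have hcorner : ∀ x, f (Γ₁.corner x) = Γ₂.corner (f x) := by
    rintro ⟨h, b⟩
    cases hs : s (G.vert h) <;> cases b
    · simp [f, corner, Γ₁.vert_rot, hs, h3 _ hs]
    · have hs' : s (G.vert (Γ₁.rot⁻¹ h)) = false := by rw [vert_rot_inv]; exact hs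
      have := h3 _ hs'
      simp only [perm_apply_inv] at this
      simp only [f, corner, hs, hs', this, Bool.xor_false]
      simp
    · simp only [f, corner, Γ₁.vert_rot, hs, h4 _ hs, Bool.xor_true, Bool.not_false, Bool.not_true]
    · have hs' : s (G.vert (Γ₁.rot⁻¹ h)) = true := by rw [vert_rot_inv]; exact hs
      have := h4 _ hs'
      simp only [perm_apply_inv] at this
      simp only [f, corner, hs, hs', this, Bool.xor_true, Bool.not_false, Bool.not_true]
      simp
  have hsurj : ∀ y, ∃ x, f x = y := by
    rintro ⟨h, b⟩
    exact ⟨(α⁻¹ h, b ^^ s (G.vert (α⁻¹ h))), by simp [f]⟩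
  let F : Γ₁.Face → Γ₂.Face := Quot.map f (by
    rintro x y (rfl | rfl)
    · exact Or.inl (hstrand x)
    · right
      simpa [arc] using hcorner x)
  have hF : ∀ x, F (Γ₁.face x) = Γ₂.face (f x) := fun x => rfl
  have hFs : Function.Surjective F := by
    intro y
    obtain ⟨y, rfl⟩ := Quot.exists_rep y
    obtain ⟨x, rfl⟩ := hsurj y
    exact ⟨Γ₁.face x, rfl⟩
  have hcol : ∀ (c : Γ₂.Face → Fin n) v, Γ₁.colorsAt (c ∘ F) v = Γ₂.colorsAt c (φ v) := by
    intro c v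
    ext k
    constructor
    · rintro ⟨x, rfl, rfl⟩
      exact ⟨f x, h1 _, rfl⟩
    · rintro ⟨y, hy, rfl⟩
      obtain ⟨x, rfl⟩ := hsurj y
      refine ⟨x, φ.injective ?_, rfl⟩
      rw [← h1]; exact hy
  have : Finite Γ₁.Face := Quot.finite _
  refine Nat.card_le_card_of_injective
    (fun c : {c : Γ₂.Face → Fin n // Γ₂.IsPartialFaceColoring c} =>
      (⟨c.1 ∘ F, fun v => by rw [hcol]; exact c.2 (φ v)⟩ :
        {c : Γ₁.Face → Fin n // Γ₁.IsPartialFaceColoring c})) ?_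
  intro c d hcd
  exact Subtype.ext (hFs.injective_comp_right (congrArg Subtype.val hcd))

instance [Finite E] : Finite (RibbonGraph G) := by
  refine Finite.of_injective (fun Γ => (Γ.rot, Γ.twist)) ?_
  rintro ⟨r, _, _, t⟩ ⟨r', _, _, t'⟩ h
  simp only [Prod.mk.injEq] at h
  obtain ⟨rfl, rfl⟩ := h
  rfl

/-- The number of partial `n`-face colorings of an equivalence class of ribbon graphs. -/
noncomputable def classColorings [Finite E] (n : ℕ) : Quotient (setoid G) → ℕ :=
  Quotient.lift (fun Γ => Γ.numPartialFaceColorings n) fun _ _ h =>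
    le_antisymm (Equivalent.numPartialFaceColorings_le (Equivalent.symm h) n)
      (Equivalent.numPartialFaceColorings_le h n)

/-- The number of partial `n`-face colorings of all distinct (i.e. pairwise inequivalent) oriented
ribbon graphs of `G` that are even with respect to `Γ`. The sum is finite. -/
noncomputable def evenColorings [Fintype E] (Γ : RibbonGraph G) (n : ℕ) : ℕ :=
  ∑ᶠ c ∈ {c : Quotient (setoid G) |
    ∃ Γ' : RibbonGraph G, ⟦Γ'⟧ = c ∧ Γ'.IsOrientable ∧ Γ'.IsEvenWithRespectTo Γ},
    classColorings n c

/-- The number of partial `n`-face colorings of all distinct (i.e. pairwise inequivalent) oriented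
ribbon graphs of `G` that are odd with respect to `Γ`. The sum is finite. -/
noncomputable def oddColorings [Fintype E] (Γ : RibbonGraph G) (n : ℕ) : ℕ :=
  ∑ᶠ c ∈ {c : Quotient (setoid G) |
    ∃ Γ' : RibbonGraph G, ⟦Γ'⟧ = c ∧ Γ'.IsOrientable ∧ Γ'.IsOddWithRespectTo Γ},
    classColorings n c

end RibbonGraph

open Classical in
/-- The vertex polynomial of the graph: that of any nonnegative oriented ribbon graph of `G`. -/
noncomputable def Multigraph.vertexPolynomial {V : Type*} {E : Type*} [Fintype V] [DecidableEq V]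
    (G : Multigraph V E) : ℤ[X] :=
  if h : ∃ Γ : RibbonGraph G, Γ.IsOrientable ∧ Γ.IsNonnegative then h.choose.vertexPolynomial
  else 0

/-! A 1-smoothing at a vertex amounts to reversing its cyclic order, so the circles of the state `ν`
are the faces of `Γ.flip ν` (`arc_eq_corner_flip`), and `n ^ k_ν` counts all colorings of these
faces. A coloring with only one color at some vertex `v` stays constant along faces when the order
at `v` is reversed, while the sign of the state changes. These colorings cancel and leave the signed
number of partial colorings, `signedColorings` (`eval_vertexPolynomial`).

Three half-edges have just two cyclic orders, and an orientable twist pattern can be switched into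
any other, so every oriented ribbon graph is equivalent to some `Γ.flip ν`. Switching discs turns
`Γ.flip ν` into `Γ` with half-twists on the edges where `ν` differs at the two ends. As each vertex
has an odd number of half-edges, the number of these edges has the parity of `|ν|`
(`neg_one_pow_sum_eq_stateSign`), so the sign of a state is the parity of its ribbon graph.

Without loops, a trivial automorphism group forces an equivalence to fix all half-edges. By
connectedness it then reverses all discs or none, so each class arises from exactly two states, `ν`
and its complement; they have equal sign, whence the factor 2 (`two_mul_finsum_parityClasses`).

Exchanging the two ends of a loop is invisible to permutations of vertices and edges, so loops are
not excluded. With a loop both sides vanish: the exchange reverses the cyclic order at its vertex,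
which cancels the signed sum and identifies even with odd classes. -/

/-- The sign `(-1) ^ #{v | ν v = true}` of a state. -/
def stateSign {V : Type*} [Fintype V] (ν : V → Bool) : ℤ := ∏ v, if ν v then -1 else 1

/-! ### Signs of states and sign-reversing involutions -/

section StateSign

variable {V : Type*} [Fintype V]

theorem stateSign_eq_pow [DecidableEq V] (ν : V → Bool) :
    stateSign ν = (-1) ^ (Finset.univ.filter fun v => ν v = true).card := by
  simp [stateSign, Finset.prod_ite]

theorem stateSign_xor (ν μ : V → Bool) :
    stateSign (fun v => ν v ^^ μ v) = stateSign ν * stateSign μ := by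
  unfold stateSign
  rw [← Finset.prod_mul_distrib]
  refine Finset.prod_congr rfl fun v _ => ?_
  beta_reduce
  generalize ν v = a
  generalize μ v = b
  cases a <;> cases b <;> simp

theorem stateSign_eq_one_or (ν : V → Bool) : stateSign ν = 1 ∨ stateSign ν = -1 := by
  classical
  rw [stateSign_eq_pow]; exact neg_one_pow_eq_or ℤ _

theorem stateSign_single [DecidableEq V] (v : V) : stateSign (fun u => decide (u = v)) = -1 := by
  simp [stateSign, Finset.prod_ite_eq']

/-- Adding a fixed state modulo 2. -/
def xorEquiv {V : Type*} (μ : V → Bool) : (V → Bool) ≃ (V → Bool) where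
  toFun ν v := ν v ^^ μ v
  invFun ν v := ν v ^^ μ v
  left_inv ν := by funext v; simp
  right_inv ν := by funext v; simp

/-- Toggling the state at `v` is a sign-reversing involution. It serves both for monochromatic
vertices and for vertices with a loop. -/
theorem sum_eq_zero_of_xor_single_neg [DecidableEq V] (v : V) (f : (V → Bool) → ℤ)
    (hf : ∀ ν, f (fun u => ν u ^^ decide (u = v)) = f ν) :
    ∑ ν, stateSign ν * f ν = 0 := by
  have h : ∑ ν, stateSign ν * f ν = ∑ ν, -(stateSign ν * f ν) := by
    rw [← (xorEquiv fun u => decide (u = v)).sum_comp]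
    refine Finset.sum_congr rfl fun ν _ => ?_
    simp only [xorEquiv, Equiv.coe_fn_mk]
    rw [stateSign_xor, stateSign_single, hf]; ring
  rw [Finset.sum_neg_distrib] at h
  linarith

end StateSign

/-! ### Parity of coboundaries, connectedness and automorphisms -/

namespace Multigraph

variable {V : Type*} {E : Type*} {G : Multigraph V E}

theorem eq_or_eq_opp {h h' : E × Bool} (H : h.1 = h'.1) : h = h' ∨ h = opp h' := by
  obtain ⟨e, b⟩ := h
  obtain ⟨e', b'⟩ := h'
  obtain rfl : e = e' := H
  cases b <;> cases b' <;> simp [opp]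

/-- The sum modulo 2 of the values of `s` at the two ends of an edge. -/
def coboundary (G : Multigraph V E) (s : V → Bool) (e : E) : Bool :=
  s (G.endpt e false) ^^ s (G.endpt e true)

theorem coboundary_fst (s : V → Bool) (h : E × Bool) :
    G.coboundary s h.1 = (s (G.vert h) ^^ s (G.vert (opp h))) := by
  obtain ⟨e, b⟩ := h
  cases b <;> simp [coboundary, vert, opp, Bool.xor_comm]

theorem coboundary_xor (s t : V → Bool) (e : E) :
    G.coboundary (fun v => s v ^^ t v) e = (G.coboundary s e ^^ G.coboundary t e) := by
  unfold coboundary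
  simp only [Bool.xor_assoc, Bool.xor_left_comm]

/-- Double counting over half-edges: grouped by edges, the product of the vertex signs gives the
left side; grouped by vertices, each sign occurs cubed, hence once. -/
theorem neg_one_pow_sum_eq_stateSign [Fintype V] [Fintype E] (htri : G.IsTrivalent) (s : V → Bool)
    (k : E → ℕ) (hk : ∀ e, (k e).bodd = G.coboundary s e) :
    (-1 : ℤ) ^ (∑ e, k e) = stateSign s := by
  classical
  let σ : Bool → ℤ := fun b => if b then -1 else 1
  have hσ : ∀ b c, σ (b ^^ c) = σ b * σ c := by decide
  have h1 : ∀ e, (-1 : ℤ) ^ k e = σ (s (G.vert (e, false))) * σ (s (G.vert (e, true))) := by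
    intro e
    have h2 : (-1 : ℤ) ^ k e = σ (k e).bodd := by
      rcases Nat.even_or_odd (k e) with h | h
      · have : (k e).bodd = false := by
          obtain ⟨m, hm⟩ := h; rw [hm]; simp [Nat.bodd_add]
        rw [h.neg_one_pow, this]; rfl
      · have : (k e).bodd = true := by
          obtain ⟨m, hm⟩ := h; rw [hm, two_mul]; simp [Nat.bodd_add]
        rw [h.neg_one_pow, this]; rfl
    rw [h2, hk, coboundary, hσ]; rfl
  rw [← Finset.prod_pow_eq_pow_sum, Finset.prod_congr rfl fun e _ => h1 e]
  have h3 : ∏ h : E × Bool, σ (s (G.vert h)) =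
      ∏ e, σ (s (G.vert (e, false))) * σ (s (G.vert (e, true))) := by
    rw [Fintype.prod_prod_type]
    refine Finset.prod_congr rfl fun e _ => ?_
    rw [Fintype.prod_bool, mul_comm]
  rw [← h3, ← Finset.prod_fiberwise Finset.univ G.vert, stateSign]
  refine Finset.prod_congr rfl fun v _ => ?_
  have h4 : (Finset.univ.filter fun h => G.vert h = v).card = 3 := by
    rw [← htri v, Nat.card_eq_fintype_card, Fintype.card_subtype]
  rw [Finset.prod_congr rfl (g := fun _ => σ (s v)) (by
    intro h hh; rw [(Finset.mem_filter.mp hh).2]), Finset.prod_const, h4]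
  cases s v <;> rfl

/-- A trivalent graph has an even number of vertices: the coboundary of the full vertex set is
empty, so `k = 0` is allowed in the parity formula. -/
theorem stateSign_true [Fintype V] [Fintype E] (htri : G.IsTrivalent) :
    stateSign (fun _ : V => true) = 1 := by
  rw [← neg_one_pow_sum_eq_stateSign htri (fun _ => true) (fun _ => 0)
    (fun e => by simp [coboundary])]
  simp

theorem stateSign_not [Fintype V] [Fintype E] (htri : G.IsTrivalent) (s : V → Bool) :
    stateSign (fun v => !s v) = stateSign s := by
  have := stateSign_xor s (fun _ => true)
  simpa [stateSign_true htri] using this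

theorem eq_of_isConnected (hconn : G.IsConnected) {s : V → Bool}
    (hs : ∀ e, G.coboundary s e = false) (u v : V) : s u = s v := by
  have hadj : ∀ h, s (G.vert h) = s (G.vert (opp h)) := by
    intro h
    have := hs h.1
    rw [coboundary_fst] at this
    simpa using this
  obtain ⟨w⟩ := hconn.preconnected u v
  induction w with
  | nil => rfl
  | cons hA _ ih =>
    rw [← ih]
    rw [SimpleGraph.fromRel_adj] at hA
    obtain ⟨-, ⟨h, rfl, rfl⟩ | ⟨h, rfl, rfl⟩⟩ := hA
    · exact hadj h
    · exact (hadj h).symm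

/-- Automorphisms of the half-edge structure of a graph without loops and nontrivial
automorphisms. -/
theorem HasTrivialAutomorphismGroup.eq_one [Finite E] (haut : G.HasTrivialAutomorphismGroup)
    (hloop : ∀ e, G.endpt e false ≠ G.endpt e true) {φ : Equiv.Perm V}
    {α : Equiv.Perm (E × Bool)} (h1 : ∀ h, G.vert (α h) = φ (G.vert h))
    (h2 : ∀ h, α (opp h) = opp (α h)) : φ = 1 ∧ α = 1 := by
  have hinj : Function.Injective fun e => (α (e, false)).1 := by
    intro e e' hee
    rcases eq_or_eq_opp hee with h | h
    · exact congrArg Prod.fst (α.injective h)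
    · rw [← h2] at h
      exact congrArg Prod.fst (α.injective h)
  let ψ : Equiv.Perm E := Equiv.ofBijective _ (Finite.injective_iff_bijective.mp hinj)
  have hψ : ∀ e, ψ e = (α (e, false)).1 := fun e => rfl
  have hA : G.IsAutomorphism φ ψ := by
    intro e
    have hf := h1 (e, false)
    have ht := h1 (e, true)
    have ho : α (e, true) = opp (α (e, false)) := h2 (e, false)
    rw [ho] at ht
    rw [hψ]
    generalize α (e, false) = x at hf ht
    obtain ⟨e', b⟩ := x
    simp only [vert, opp] at hf ht
    rw [← hf, ← ht]
    cases b
    · rfl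
    · exact Sym2.eq_swap
  obtain ⟨rfl, hψ1⟩ := haut φ ψ hA
  refine ⟨rfl, Equiv.ext fun h => ?_⟩
  have hfst : (α h).1 = h.1 := by
    obtain ⟨e, b⟩ := h
    have he : (α (e, false)).1 = e := by rw [← hψ, hψ1]; rfl
    cases b
    · exact he
    · have ho : α (e, true) = opp (α (e, false)) := h2 (e, false)
      rw [ho]; exact he
  -- Each edge is fixed, so its ends are fixed or exchanged; an exchange would move a vertex, since
  -- no edge is a loop.
  rcases eq_or_eq_opp hfst with h' | h'
  · exact h'
  · have := h1 h
    rw [h'] at this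
    obtain ⟨e, b⟩ := h
    cases b
    · exact absurd this.symm (hloop e)
    · exact absurd this (hloop e)

end Multigraph

/-! ### Reversed cyclic orders and switched discs -/

namespace RibbonGraph

open Multigraph

variable {V : Type*} {E : Type*} {G : Multigraph V E}

theorem ext_rot_twist {Γ₁ Γ₂ : RibbonGraph G} (hr : ∀ h, Γ₁.rot h = Γ₂.rot h)
    (ht : ∀ e, Γ₁.twist e = Γ₂.twist e) : Γ₁ = Γ₂ := by
  obtain ⟨r, _, _, t⟩ := Γ₁
  obtain ⟨r', _, _, t'⟩ := Γ₂
  obtain rfl : r = r' := Equiv.ext hr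
  obtain rfl : t = t' := funext ht
  rfl

theorem rot_inv_rot (Γ : RibbonGraph G) (h : E × Bool) : Γ.rot⁻¹ (Γ.rot h) = h :=
  Γ.rot.symm_apply_apply h

/-- The cyclic orders reversed at the vertices `v` with `S v = true`. -/
def flipRot (Γ : RibbonGraph G) (S : V → Bool) : Equiv.Perm (E × Bool) where
  toFun h := if S (G.vert h) then Γ.rot⁻¹ h else Γ.rot h
  invFun h := if S (G.vert h) then Γ.rot h else Γ.rot⁻¹ h
  left_inv h := by
    cases hS : S (G.vert h)
    · simp only [Bool.false_eq_true, if_false, Γ.vert_rot, hS, rot_inv_rot]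
    · simp only [if_true, vert_rot_inv, hS, perm_apply_inv]
  right_inv h := by
    cases hS : S (G.vert h)
    · simp only [Bool.false_eq_true, if_false, vert_rot_inv, hS, perm_apply_inv]
    · simp only [if_true, Γ.vert_rot, hS, rot_inv_rot]

theorem flipRot_apply (Γ : RibbonGraph G) (S : V → Bool) (h : E × Bool) :
    Γ.flipRot S h = if S (G.vert h) then Γ.rot⁻¹ h else Γ.rot h := rfl

theorem flipRot_inv_apply (Γ : RibbonGraph G) (S : V → Bool) (h : E × Bool) :
    (Γ.flipRot S)⁻¹ h = if S (G.vert h) then Γ.rot h else Γ.rot⁻¹ h := rfl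

theorem vert_rot_zpow (Γ : RibbonGraph G) (h : E × Bool) (i : ℤ) :
    G.vert ((Γ.rot ^ i) h) = G.vert h := by
  induction i with
  | zero => rfl
  | succ i ih => rw [add_comm, zpow_add, zpow_one, Equiv.Perm.mul_apply, Γ.vert_rot, ih]
  | pred i ih =>
    rw [sub_eq_add_neg, add_comm, zpow_add, zpow_neg_one, Equiv.Perm.mul_apply, vert_rot_inv, ih]

theorem flipRot_zpow_apply (Γ : RibbonGraph G) (S : V → Bool) (h : E × Bool) (i : ℤ) :
    (Γ.flipRot S ^ i) h = (Γ.rot ^ (if S (G.vert h) then -i else i)) h := by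
  induction i with
  | zero => simp
  | succ i ih =>
    rw [add_comm, zpow_add, zpow_one, Equiv.Perm.mul_apply, ih, flipRot_apply, vert_rot_zpow]
    cases S (G.vert h)
    · simp [zpow_add]
    · rw [if_pos rfl, if_pos rfl, if_pos rfl, neg_add, zpow_add, zpow_neg_one]; rfl
  | pred i ih =>
    rw [sub_eq_add_neg, add_comm, zpow_add, zpow_neg_one, Equiv.Perm.mul_apply, ih,
      flipRot_inv_apply, vert_rot_zpow]
    cases S (G.vert h)
    · simp [zpow_add]
    · rw [if_pos rfl, if_pos rfl, if_pos rfl, neg_add, neg_neg, zpow_add,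
        neg_neg, zpow_one]; rfl

/-- The ribbon graph with the cyclic orders reversed at the vertices `v` with `S v = true`. -/
def flip (Γ : RibbonGraph G) (S : V → Bool) : RibbonGraph G where
  rot := Γ.flipRot S
  vert_rot h := by
    rw [flipRot_apply]
    split_ifs
    · exact Γ.vert_rot_inv h
    · exact Γ.vert_rot h
  sameCycle_rot h h' H := by
    obtain ⟨i, hi⟩ := Γ.sameCycle_rot h h' H
    refine ⟨if S (G.vert h) then -i else i, ?_⟩
    rw [flipRot_zpow_apply, ← hi]
    split_ifs <;> simp
  twist := Γ.twist

theorem flip_rot (Γ : RibbonGraph G) (S : V → Bool) (h : E × Bool) :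
    (Γ.flip S).rot h = if S (G.vert h) then Γ.rot⁻¹ h else Γ.rot h := rfl

theorem flip_rot_inv (Γ : RibbonGraph G) (S : V → Bool) (h : E × Bool) :
    (Γ.flip S).rot⁻¹ h = if S (G.vert h) then Γ.rot h else Γ.rot⁻¹ h := rfl

theorem flip_flip (Γ : RibbonGraph G) (S T : V → Bool) :
    (Γ.flip S).flip T = Γ.flip fun v => S v ^^ T v := by
  refine ext_rot_twist (fun h => ?_) fun _ => rfl
  rw [flip_rot, flip_rot, flip_rot_inv, flip_rot]
  cases S (G.vert h) <;> cases T (G.vert h) <;> rfl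

/-- Reversing the orientations of some vertex discs gives an equivalent ribbon graph. -/
theorem Equivalent.of_switch {Γ₁ Γ₂ : RibbonGraph G} (s : V → Bool)
    (hr : ∀ h, Γ₂.rot h = (Γ₁.flip s).rot h)
    (ht : ∀ e, Γ₂.twist e = (Γ₁.twist e ^^ G.coboundary s e)) : Γ₁.Equivalent Γ₂ := by
  have hr' : Γ₂.rot = (Γ₁.flip s).rot := Equiv.ext hr
  refine ⟨1, 1, s, fun _ => rfl, fun _ => rfl, ?_, ?_, ?_⟩
  · intro h hs
    rw [Equiv.Perm.one_apply, Equiv.Perm.one_apply, hr, flip_rot, hs]; rfl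
  · intro h hs
    rw [Equiv.Perm.one_apply, Equiv.Perm.one_apply, hr', flip_rot_inv, hs]; rfl
  · intro h
    rw [Equiv.Perm.one_apply, ht, coboundary_fst]

/-- An equivalence that is the identity on the graph reverses some vertex discs. -/
theorem switch_of_equivalent_one {Γ₁ Γ₂ : RibbonGraph G} {s : V → Bool}
    (h3 : ∀ h, s (G.vert h) = false → Γ₁.rot h = Γ₂.rot h)
    (h4 : ∀ h, s (G.vert h) = true → Γ₁.rot h = Γ₂.rot⁻¹ h)
    (h5 : ∀ h : E × Bool,
      Γ₂.twist h.1 = (Γ₁.twist h.1 ^^ (s (G.vert h) ^^ s (G.vert (opp h))))) :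
    (∀ h, Γ₁.rot h = (Γ₂.flip s).rot h) ∧
      ∀ e, Γ₂.twist e = (Γ₁.twist e ^^ G.coboundary s e) := by
  refine ⟨fun h => ?_, fun e => ?_⟩
  · rw [flip_rot]
    cases hs : s (G.vert h)
    · exact h3 h hs
    · exact h4 h hs
  · rw [h5 (e, false), ← coboundary_fst]

theorem numPartialFaceColorings_congr [Finite E] {Γ₁ Γ₂ : RibbonGraph G} (H : Γ₁.Equivalent Γ₂)
    (n : ℕ) : Γ₁.numPartialFaceColorings n = Γ₂.numPartialFaceColorings n :=
  le_antisymm (Equivalent.numPartialFaceColorings_le H.symm n)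
    (Equivalent.numPartialFaceColorings_le H n)

/-! ### Cyclic orders on three half-edges -/

theorem ncard_fiber (htri : G.IsTrivalent) (v : V) : {h | G.vert h = v}.ncard = 3 := htri v

theorem rot_ne (htri : G.IsTrivalent) (Γ : RibbonGraph G) (h : E × Bool) : Γ.rot h ≠ h := by
  intro H
  have hs : {h' | G.vert h' = G.vert h} ⊆ {h} := by
    intro h' hh
    obtain ⟨i, hi⟩ := Γ.sameCycle_rot h h' (Eq.symm hh)
    rw [Equiv.Perm.zpow_apply_eq_self_of_apply_eq_self H] at hi
    exact hi.symm
  have := Set.ncard_le_ncard hs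
  rw [ncard_fiber htri, Set.ncard_singleton] at this
  omega

theorem rot_rot_ne (htri : G.IsTrivalent) (Γ : RibbonGraph G) (h : E × Bool) :
    Γ.rot (Γ.rot h) ≠ h := by
  intro H
  have hs : {h' | G.vert h' = G.vert h} ⊆ {h, Γ.rot h} := by
    intro h' hh
    obtain ⟨i, hi⟩ := Γ.sameCycle_rot h h' (Eq.symm hh)
    rcases Equiv.Perm.zpow_apply_eq_of_apply_apply_eq_self H i with h1 | h1
    · rw [h1] at hi; simp [hi]
    · rw [h1] at hi; simp [hi]
  have := Set.ncard_le_ncard hs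
  rw [ncard_fiber htri, Set.ncard_pair (rot_ne htri Γ h).symm] at this
  omega

theorem eq_of_vert_eq (htri : G.IsTrivalent) (Γ : RibbonGraph G) {h h' : E × Bool}
    (H : G.vert h' = G.vert h) : h' = h ∨ h' = Γ.rot h ∨ h' = Γ.rot (Γ.rot h) := by
  have hsub : {h, Γ.rot h, Γ.rot (Γ.rot h)} ⊆ {h' | G.vert h' = G.vert h} := by
    rintro x (rfl | rfl | rfl) <;> simp [Γ.vert_rot]
  have hc : ({h, Γ.rot h, Γ.rot (Γ.rot h)} : Set (E × Bool)).ncard = 3 :=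
    Set.ncard_eq_three.mpr ⟨_, _, _, (rot_ne htri Γ h).symm, (rot_rot_ne htri Γ h).symm,
      (rot_ne htri Γ _).symm, rfl⟩
  have hfin : {h' | G.vert h' = G.vert h}.Finite :=
    Set.finite_of_ncard_ne_zero (by rw [ncard_fiber htri]; omega)
  have heq := Set.eq_of_subset_of_ncard_le hsub (by rw [hc, ncard_fiber htri]) hfin
  have : h' ∈ {h' | G.vert h' = G.vert h} := H
  rw [← heq] at this
  simpa using this

theorem rot_rot_rot (htri : G.IsTrivalent) (Γ : RibbonGraph G) (h : E × Bool) :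
    Γ.rot (Γ.rot (Γ.rot h)) = h := by
  rcases eq_of_vert_eq htri Γ (h := h) (h' := Γ.rot (Γ.rot (Γ.rot h)))
    (by simp only [Γ.vert_rot]) with H | H | H
  · exact H
  · exact absurd (Γ.rot.injective H) (rot_rot_ne htri Γ h)
  · exact absurd H (rot_ne htri Γ _)

theorem rot_inv_eq (htri : G.IsTrivalent) (Γ : RibbonGraph G) (h : E × Bool) :
    Γ.rot⁻¹ h = Γ.rot (Γ.rot h) := by
  apply Γ.rot.injective
  rw [perm_apply_inv, rot_rot_rot htri]

/-- On three half-edges a cyclic order is determined by one successor. -/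
theorem rot_eq_of_rot_eq (htri : G.IsTrivalent) {Γ₁ Γ₂ : RibbonGraph G} {h h' : E × Bool}
    (H : Γ₁.rot h = Γ₂.rot h) (hv : G.vert h' = G.vert h) : Γ₁.rot h' = Γ₂.rot h' := by
  have h2 : Γ₁.rot (Γ₁.rot h) = Γ₂.rot (Γ₂.rot h) := by
    rcases eq_of_vert_eq htri Γ₂ (h := h) (h' := Γ₁.rot (Γ₁.rot h))
      (by simp only [Γ₁.vert_rot]) with K | K | K
    · exact absurd K (rot_rot_ne htri Γ₁ h)
    · rw [← H] at K; exact absurd K (rot_ne htri Γ₁ _)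
    · exact K
  rcases eq_of_vert_eq htri Γ₁ hv with rfl | rfl | rfl
  · exact H
  · rw [h2, H]
  · rw [rot_rot_rot htri, h2, rot_rot_rot htri]

theorem exists_flip_rot_eq (htri : G.IsTrivalent) (Γ₁ Γ₂ : RibbonGraph G) :
    ∃ S : V → Bool, ∀ h, Γ₁.rot h = (Γ₂.flip S).rot h := by
  classical
  refine ⟨fun v => decide (∃ h, G.vert h = v ∧ Γ₁.rot h ≠ Γ₂.rot h), fun h => ?_⟩
  rw [flip_rot]
  split_ifs with hS
  · obtain ⟨h', hv, hne⟩ := of_decide_eq_true hS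
    -- At a vertex where the orders disagree somewhere, the first one is the reverse of the second;
    -- comparing with the fully reversed `Γ₂` makes one successor suffice.
    refine rot_eq_of_rot_eq (Γ₂ := Γ₂.flip fun _ => true) htri (h := h') ?_ hv.symm
    rw [flip_rot, if_pos rfl, rot_inv_eq htri]
    rcases eq_of_vert_eq htri Γ₂ (Γ₁.vert_rot h') with K | K | K
    · exact absurd K (rot_ne htri Γ₁ _)
    · exact absurd K hne
    · exact K
  · by_contra hne
    exact hS (decide_eq_true ⟨h, rfl, hne⟩)

/-- Any two orientable ribbon graphs differ, up to equivalence, by reversed cyclic orders. -/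
theorem IsOrientable.exists_coboundary {Γ₁ Γ₂ : RibbonGraph G} (h1 : Γ₁.IsOrientable)
    (h2 : Γ₂.IsOrientable) :
    ∃ t : V → Bool, ∀ e, Γ₂.twist e = (Γ₁.twist e ^^ G.coboundary t e) := by
  obtain ⟨s₁, hs₁⟩ := h1
  obtain ⟨s₂, hs₂⟩ := h2
  -- Both twist functions are coboundaries, so their difference is one too.
  refine ⟨fun v => s₁ v ^^ s₂ v, fun e => ?_⟩
  rw [coboundary_xor, show Γ₁.twist e = G.coboundary s₁ e from hs₁ e,
    show Γ₂.twist e = G.coboundary s₂ e from hs₂ e, ← Bool.xor_assoc, Bool.xor_self,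
    Bool.false_xor]

/-- Switching the discs in `t` trades a difference in twists for further reversed cyclic orders. -/
theorem equivalent_flip_of_switch {Γ₁ Γ₂ : RibbonGraph G} {S t : V → Bool}
    (hr : ∀ h, Γ₁.rot h = (Γ₂.flip S).rot h)
    (ht : ∀ e, Γ₂.twist e = (Γ₁.twist e ^^ G.coboundary t e)) :
    Γ₁.Equivalent (Γ₂.flip fun v => S v ^^ t v) := by
  refine Equivalent.of_switch t (fun h => ?_) ht
  have hr' : Γ₁.rot = (Γ₂.flip S).rot := Equiv.ext hr
  rw [← flip_flip, flip_rot, flip_rot _ t, hr']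

/-! ### A loop -/

/-- A transposition of two of three cyclically ordered elements reverses the cyclic order. -/
theorem rot_swap_loop [DecidableEq E] (htri : G.IsTrivalent) (Γ : RibbonGraph G) {e : E}
    (he : G.endpt e false = G.endpt e true) {h : E × Bool} (hv : G.vert h = G.endpt e false) :
    Equiv.swap (e, false) (e, true) (Γ.rot h) =
      Γ.rot⁻¹ (Equiv.swap (e, false) (e, true) h) := by
  have key : ∀ a b : E × Bool, b = Γ.rot a → G.vert h = G.vert a →
      Equiv.swap a b (Γ.rot h) = Γ.rot⁻¹ (Equiv.swap a b h) := by
    rintro a b rfl hva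
    have n1 := rot_ne htri Γ a
    have n2 := rot_rot_ne htri Γ a
    have n3 := rot_ne htri Γ (Γ.rot a)
    rcases eq_of_vert_eq htri Γ hva with rfl | rfl | rfl
    · rw [Equiv.swap_apply_right, Equiv.swap_apply_left, rot_inv_rot]
    · rw [Equiv.swap_apply_right, Equiv.swap_apply_of_ne_of_ne n2 n3, rot_inv_eq htri]
    · rw [rot_rot_rot htri, Equiv.swap_apply_left, Equiv.swap_apply_of_ne_of_ne n2 n3, rot_inv_rot]
  have hne : (e, true) ≠ (e, false) := by simp
  rcases eq_of_vert_eq htri Γ (h := (e, false)) (h' := (e, true)) he.symm with K | K | K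
  · exact absurd K hne
  · exact key _ _ K hv
  · rw [Equiv.swap_comm]
    refine key _ _ ?_ (hv.trans he)
    rw [K, rot_rot_rot htri]

theorem equivalent_flip_loop [DecidableEq V] (htri : G.IsTrivalent) (Γ : RibbonGraph G) {e : E}
    (he : G.endpt e false = G.endpt e true) :
    Γ.Equivalent (Γ.flip fun u => decide (u = G.endpt e false)) := by
  classical
  have hfst : ∀ h, (Equiv.swap (e, false) (e, true) h).1 = h.1 := by
    intro h
    rw [Equiv.swap_apply_def]
    split_ifs with h1 h2
    · rw [h1]
    · rw [h2]
    · rfl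
  have hvert : ∀ h, G.vert (Equiv.swap (e, false) (e, true) h) = G.vert h := by
    intro h
    rw [Equiv.swap_apply_def]
    split_ifs with h1 h2
    · rw [h1]; exact he.symm
    · rw [h2]; exact he
    · rfl
  -- The equivalence exchanges the ends of the loop and reverses no disc.
  refine ⟨1, Equiv.swap (e, false) (e, true), fun _ => false, hvert, ?_, ?_, ?_, ?_⟩
  · rintro ⟨e', b⟩
    by_cases hee : e' = e
    · subst hee
      cases b <;> simp [opp]
    · rw [Equiv.swap_apply_of_ne_of_ne, Equiv.swap_apply_of_ne_of_ne] <;> simp [opp, hee]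
  · intro h _
    rw [flip_rot, hvert]
    by_cases hv : G.vert h = G.endpt e false
    · rw [if_pos (decide_eq_true hv), rot_swap_loop htri Γ he hv]
    · have hfix : ∀ h', G.vert h' ≠ G.endpt e false →
          Equiv.swap (e, false) (e, true) h' = h' := by
        intro h' hv'
        refine Equiv.swap_apply_of_ne_of_ne ?_ ?_
        · rintro rfl; exact hv' rfl
        · rintro rfl; exact hv' he.symm
      rw [if_neg (by simpa using hv), hfix h hv, hfix _ (by rwa [Γ.vert_rot])]
  · intro h hf
    exact absurd hf (by simp)
  · intro h
    rw [hfst]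
    simp [flip]

end RibbonGraph

namespace RibbonGraph

open Multigraph

variable {V : Type*} {E : Type*} {G : Multigraph V E}

/-! ### Colorings of the sides of the bands -/

theorem arc_eq_corner_flip (Γ : RibbonGraph G) (ν : V → Bool) (x : (E × Bool) × Bool) :
    Γ.arc ν x = (Γ.flip ν).corner x := by
  obtain ⟨h, b⟩ := x
  cases b <;> simp only [arc, corner, flip_rot, flip_rot_inv, Bool.not_true, Bool.not_false] <;>
    split_ifs <;> rfl

theorem arc_false (Γ : RibbonGraph G) (x : (E × Bool) × Bool) :
    Γ.arc (fun _ => false) x = Γ.corner x := by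
  simp [arc]

/-- The circles of a state are the faces of the ribbon graph with reversed cyclic orders. -/
theorem card_stateCircle (Γ : RibbonGraph G) (ν : V → Bool) :
    Nat.card (Γ.StateCircle ν) = Nat.card (Γ.flip ν).Face := by
  unfold Face StateCircle
  simp only [arc_eq_corner_flip]
  rfl

theorem vert_corner (Γ : RibbonGraph G) (x : (E × Bool) × Bool) :
    G.vert (Γ.corner x).1 = G.vert x.1 := by
  obtain ⟨h, b⟩ := x
  cases b
  · exact Γ.vert_rot h
  · exact Γ.vert_rot_inv h

/-- A coloring of the sides of the bands is constant along the faces. -/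
def IsInvariant (Γ : RibbonGraph G) {C : Type*} (c : (E × Bool) × Bool → C) : Prop :=
  ∀ x, c (Γ.strand x) = c x ∧ c (Γ.corner x) = c x

/-- Only one color occurs at the vertex `v`. -/
def IsMonochromaticAt (G : Multigraph V E) {C : Type*} (c : (E × Bool) × Bool → C) (v : V) :
    Prop :=
  ∀ x y, G.vert x.1 = v → G.vert y.1 = v → c x = c y

theorem isInvariant_face (Γ : RibbonGraph G) {C : Type*} (c : Γ.Face → C) :
    Γ.IsInvariant fun x => c (Γ.face x) := by
  refine fun x => ⟨congrArg c (Eq.symm ?_), congrArg c (Eq.symm ?_)⟩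
  · exact Quot.sound (Or.inl rfl)
  · exact Quot.sound (Or.inr (Γ.arc_false x).symm)

/-- Colorings of the faces as invariant colorings of the sides of the bands. -/
def faceColoringEquiv (Γ : RibbonGraph G) (C : Type*) :
    (Γ.Face → C) ≃ {c : (E × Bool) × Bool → C // Γ.IsInvariant c} where
  toFun c := ⟨fun x => c (Γ.face x), Γ.isInvariant_face c⟩
  invFun c := Quot.lift c.1 (by
    rintro x y (rfl | rfl)
    · exact (c.2 x).1.symm
    · rw [arc_false]; exact (c.2 x).2.symm)
  left_inv c := by
    funext x
    obtain ⟨x, rfl⟩ := Quot.exists_rep x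
    rfl
  right_inv c := rfl

/-- If all sides at `v` have the same color, it does not matter how the arcs at `v` join them. -/
theorem IsInvariant.flip_of_agree {Γ : RibbonGraph G} {C : Type*} {c : (E × Bool) × Bool → C}
    {v : V} (hc : IsMonochromaticAt G c v) {ν μ : V → Bool} (hνμ : ∀ u, u ≠ v → ν u = μ u)
    (H : (Γ.flip ν).IsInvariant c) : (Γ.flip μ).IsInvariant c := by
  refine fun x => ⟨(H x).1, ?_⟩
  by_cases hv : G.vert x.1 = v
  · exact hc _ _ ((vert_corner _ x).trans hv) hv
  · have : (Γ.flip μ).corner x = (Γ.flip ν).corner x := by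
      rw [← arc_eq_corner_flip, ← arc_eq_corner_flip, arc, arc, hνμ _ hv]
    rw [this]; exact (H x).2

theorem ncard_colorsAt_le (htri : G.IsTrivalent) (Γ : RibbonGraph G) {n : ℕ}
    (c : Γ.Face → Fin n) (v : V) : (Γ.colorsAt c v).ncard ≤ 3 := by
  have hsub : Γ.colorsAt c v ⊆ (fun h => c (Γ.face (h, false))) '' {h | G.vert h = v} := by
    rintro k ⟨⟨h, b⟩, hv, rfl⟩
    cases b
    · exact ⟨h, hv, rfl⟩
    · refine ⟨Γ.rot⁻¹ h, (Γ.vert_rot_inv h).trans hv, ?_⟩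
      exact (Γ.isInvariant_face c (h, true)).2
  have hfin : {h | G.vert h = v}.Finite :=
    Set.finite_of_ncard_ne_zero (by rw [ncard_fiber htri]; omega)
  calc _ ≤ _ := Set.ncard_le_ncard hsub (Set.toFinite _)
    _ ≤ _ := Set.ncard_image_le hfin
    _ = 3 := ncard_fiber htri v

/-- A vertex has three corners, hence at most three colors, so the condition fails only where there
is at most one. -/
theorem isPartialFaceColoring_iff (htri : G.IsTrivalent) (Γ : RibbonGraph G) {n : ℕ}
    (c : Γ.Face → Fin n) :
    Γ.IsPartialFaceColoring c ↔ ¬ ∃ v, IsMonochromaticAt G (fun x => c (Γ.face x)) v := by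
  have key : ∀ v, (Γ.colorsAt c v).ncard ≤ 1 ↔
      IsMonochromaticAt G (fun x => c (Γ.face x)) v := by
    intro v
    rw [Set.ncard_le_one]
    constructor
    · intro H x y hx hy
      exact H _ ⟨x, hx, rfl⟩ _ ⟨y, hy, rfl⟩
    · rintro H _ ⟨x, hx, rfl⟩ _ ⟨y, hy, rfl⟩
      exact H x y hx hy
  rw [not_exists]
  refine forall_congr' fun v => ?_
  rw [← key]
  have := ncard_colorsAt_le htri Γ c v
  omega

-- The colorings that are not partial are counted as functions on the sides of the bands, a domain
-- common to all `Γ.flip ν`, so that the sums over states and colorings can be interchanged.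
open Classical in
theorem pow_card_face (htri : G.IsTrivalent) [Fintype E] (Γ : RibbonGraph G) (n : ℕ) :
    n ^ Nat.card Γ.Face = Γ.numPartialFaceColorings n +
      ∑ c : (E × Bool) × Bool → Fin n,
        if Γ.IsInvariant c ∧ ∃ v, IsMonochromaticAt G c v then 1 else 0 := by
  have : Finite Γ.Face := Quot.finite _
  have h1 : Nat.card (Γ.Face → Fin n) = n ^ Nat.card Γ.Face := by
    rw [Nat.card_fun]; simp
  rw [← h1, numPartialFaceColorings,
    Nat.card_congr (Equiv.sumCompl fun c => Γ.IsPartialFaceColoring c).symm, Nat.card_sum]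
  congr 1
  rw [← Finset.card_filter, ← Fintype.card_subtype, ← Nat.card_eq_fintype_card]
  refine Nat.card_congr ?_
  refine (Equiv.subtypeEquiv (Γ.faceColoringEquiv (Fin n)) (q := fun c =>
    ∃ v, IsMonochromaticAt G c.1 v) fun c => ?_).trans (Equiv.subtypeSubtypeEquivSubtypeInter
      (fun c => Γ.IsInvariant c) fun c => ∃ v, IsMonochromaticAt G c v)
  rw [isPartialFaceColoring_iff htri, not_not]
  rfl

/-! ### The vertex polynomial as a signed number of partial face colorings -/

section VertexSum

variable [Fintype V] [DecidableEq V]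

/-- The signed number of partial colorings of the ribbon graphs with reversed cyclic orders. -/
noncomputable def signedColorings (Γ : RibbonGraph G) (n : ℕ) : ℤ :=
  ∑ ν : V → Bool, stateSign ν * ((Γ.flip ν).numPartialFaceColorings n : ℤ)

theorem eval_vertexPolynomial [Fintype E] (htri : G.IsTrivalent)
    (Γ : RibbonGraph G) (n : ℕ) :
    Γ.vertexPolynomial.eval (n : ℤ) = Γ.signedColorings n := by
  classical
  have h1 : Γ.vertexPolynomial.eval (n : ℤ) =
      ∑ ν : V → Bool, stateSign ν * ((n ^ Nat.card (Γ.flip ν).Face : ℕ) : ℤ) := by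
    rw [vertexPolynomial, eval_finsetSum]
    refine Finset.sum_congr rfl fun ν _ => ?_
    rw [card_stateCircle, stateSign_eq_pow]
    simp
  rw [h1]
  simp only [pow_card_face htri, Nat.cast_add, mul_add, Finset.sum_add_distrib]
  rw [signedColorings, add_eq_left]
  simp only [Nat.cast_sum, Finset.mul_sum]
  rw [Finset.sum_comm]
  refine Finset.sum_eq_zero fun c _ => ?_
  -- For a fixed coloring of the sides, monochromaticity does not depend on `ν`, so one vertex can
  -- be toggled in all states.
  by_cases hc : ∃ v, IsMonochromaticAt G c v
  · have ⟨v, hv⟩ := hc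
    refine sum_eq_zero_of_xor_single_neg v _ fun ν => ?_
    have hagree : ∀ u, u ≠ v → (ν u ^^ decide (u = v)) = ν u := by
      intro u hu; simp [hu]
    have : (Γ.flip fun u => ν u ^^ decide (u = v)).IsInvariant c ↔ (Γ.flip ν).IsInvariant c :=
      ⟨IsInvariant.flip_of_agree hv hagree,
        IsInvariant.flip_of_agree hv fun u hu => (hagree u hu).symm⟩
    by_cases hi : (Γ.flip ν).IsInvariant c
    · rw [if_pos ⟨this.mpr hi, hc⟩, if_pos ⟨hi, hc⟩]
    · rw [if_neg fun h => hi (this.mp h.1), if_neg fun h => hi h.1]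
  · simp [hc]

/-- The ribbon graphs `Γ₁.flip ν` and `Γ₂.flip (ν + S + t)` are equivalent; translating the
summation index by `S + t` costs its sign. -/
theorem signedColorings_of_switch [Finite E] {Γ₁ Γ₂ : RibbonGraph G} {S t : V → Bool}
    (hr : ∀ h, Γ₁.rot h = (Γ₂.flip S).rot h)
    (ht : ∀ e, Γ₂.twist e = (Γ₁.twist e ^^ G.coboundary t e)) (n : ℕ) :
    Γ₁.signedColorings n = stateSign (fun v => S v ^^ t v) * Γ₂.signedColorings n := by
  have hr' : Γ₁.rot = (Γ₂.flip S).rot := Equiv.ext hr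
  have key : ∀ ν : V → Bool, (Γ₁.flip ν).numPartialFaceColorings n =
      (Γ₂.flip fun v => ν v ^^ (S v ^^ t v)).numPartialFaceColorings n := by
    intro ν
    refine numPartialFaceColorings_congr ?_ n
    have := equivalent_flip_of_switch (Γ₁ := Γ₁.flip ν) (Γ₂ := Γ₂) (S := fun v => S v ^^ ν v)
      (t := t) (fun h => by rw [← flip_flip, flip_rot, flip_rot _ ν, hr']) ht
    convert this using 3
    simp only [Bool.xor_assoc, Bool.xor_left_comm]
  rw [signedColorings, signedColorings, Finset.mul_sum,
    ← (xorEquiv fun v => S v ^^ t v).sum_comp fun ν => stateSign (fun v => S v ^^ t v) *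
      (stateSign ν * ((Γ₂.flip ν).numPartialFaceColorings n : ℤ))]
  refine Finset.sum_congr rfl fun ν _ => ?_
  rw [key]
  have h2 : stateSign (fun v => S v ^^ t v) * stateSign (fun v => S v ^^ t v) = 1 := by
    rcases stateSign_eq_one_or fun v => S v ^^ t v with h | h <;> rw [h] <;> rfl
  have h3 : stateSign (xorEquiv (fun v => S v ^^ t v) ν) =
      stateSign ν * stateSign (fun v => S v ^^ t v) := stateSign_xor ν _
  rw [h3]
  simp only [xorEquiv, Equiv.coe_fn_mk]
  linear_combination (-stateSign ν *
    ((Γ₂.flip fun v => ν v ^^ (S v ^^ t v)).numPartialFaceColorings n : ℤ)) * h2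

theorem IsOrientable.vertexPolynomial_eq_or_neg [Fintype E] (htri : G.IsTrivalent)
    {Γ₁ Γ₂ : RibbonGraph G} (h1 : Γ₁.IsOrientable) (h2 : Γ₂.IsOrientable) :
    (∀ n : ℕ, Γ₁.vertexPolynomial.eval (n : ℤ) = Γ₂.vertexPolynomial.eval (n : ℤ)) ∨
      ∀ n : ℕ, Γ₁.vertexPolynomial.eval (n : ℤ) = -Γ₂.vertexPolynomial.eval (n : ℤ) := by
  obtain ⟨S, hS⟩ := exists_flip_rot_eq htri Γ₁ Γ₂
  obtain ⟨t, ht⟩ := h1.exists_coboundary h2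
  simp only [eval_vertexPolynomial htri, signedColorings_of_switch hS ht]
  rcases stateSign_eq_one_or fun v => S v ^^ t v with h | h
  · left; intro n; rw [h, one_mul]
  · right; intro n; rw [h, neg_one_mul]

/-- The vertex polynomial of the graph does not depend on the chosen ribbon graph. -/
theorem IsNonnegative.eval_vertexPolynomial_eq [Fintype E] (htri : G.IsTrivalent)
    {Γ₁ Γ₂ : RibbonGraph G} (h1 : Γ₁.IsOrientable) (h2 : Γ₂.IsOrientable)
    (hn1 : Γ₁.IsNonnegative) (hn2 : Γ₂.IsNonnegative) (n : ℕ) :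
    Γ₁.vertexPolynomial.eval (n : ℤ) = Γ₂.vertexPolynomial.eval (n : ℤ) := by
  rcases h1.vertexPolynomial_eq_or_neg htri h2 with h | h
  · exact h n
  -- Opposite values that are both eventually nonnegative vanish at infinitely many integers.
  · have hz : Γ₂.vertexPolynomial = 0 := by
      obtain ⟨N, hN⟩ := Filter.eventually_atTop.mp (hn1.and hn2)
      refine eq_zero_of_infinite_isRoot _ (Set.Infinite.mono
        (s := (fun m : ℕ => (m : ℤ)) '' Set.Ici N) ?_
        ((Set.Ici_infinite N).image Nat.cast_injective.injOn))
      rintro _ ⟨m, hm, rfl⟩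
      have hp := hN m hm
      rw [h m] at hp
      change Γ₂.vertexPolynomial.eval (m : ℤ) = 0
      linarith [hp.1, hp.2]
    rw [h n, hz]; simp

theorem eval_graph_vertexPolynomial [Fintype E] (htri : G.IsTrivalent)
    {Γ : RibbonGraph G} (hor : Γ.IsOrientable) (hnonneg : Γ.IsNonnegative) (n : ℕ) :
    G.vertexPolynomial.eval (n : ℤ) = Γ.signedColorings n := by
  have hex : ∃ Γ : RibbonGraph G, Γ.IsOrientable ∧ Γ.IsNonnegative := ⟨Γ, hor, hnonneg⟩
  rw [Multigraph.vertexPolynomial, dif_pos hex, ← eval_vertexPolynomial htri]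
  exact IsNonnegative.eval_vertexPolynomial_eq htri hex.choose_spec.1 hor hex.choose_spec.2
    hnonneg n

end VertexSum

/-! ### Parity classes -/

section Classes

variable [Fintype E]

/-- The classes of oriented ribbon graphs that become equivalent to `Γ` by inserting half-twists
whose number has parity `ε`. -/
def parityClasses (Γ : RibbonGraph G) (ε : ℤ) : Set (Quotient (setoid G)) :=
  {c | ∃ Γ' : RibbonGraph G, ⟦Γ'⟧ = c ∧ Γ'.IsOrientable ∧
    ∃ k : E → ℕ, (-1 : ℤ) ^ (∑ e, k e) = ε ∧ (Γ'.insertHalfTwists k).Equivalent Γ}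

theorem evenColorings_eq (Γ : RibbonGraph G) (n : ℕ) :
    Γ.evenColorings n = ∑ᶠ c ∈ Γ.parityClasses 1, classColorings n c := by
  unfold parityClasses
  simp only [neg_one_pow_eq_one_iff_even (show (-1 : ℤ) ≠ 1 by decide)]
  rfl

theorem oddColorings_eq (Γ : RibbonGraph G) (n : ℕ) :
    Γ.oddColorings n = ∑ᶠ c ∈ Γ.parityClasses (-1), classColorings n c := by
  unfold parityClasses
  simp only [neg_one_pow_eq_neg_one_iff_odd (show (-1 : ℤ) ≠ 1 by decide)]
  rfl

/-- Exchanging the ends of the loop reverses the order at its vertex, and switching that disc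
restores it at the cost of half-twists on the coboundary of the vertex. Their number is odd. -/
theorem parityClasses_subset_of_loop [Fintype V] [DecidableEq V] (htri : G.IsTrivalent)
    (Γ : RibbonGraph G) {e : E} (he : G.endpt e false = G.endpt e true) (ε : ℤ) :
    Γ.parityClasses ε ⊆ Γ.parityClasses (-ε) := by
  rintro c ⟨Γ', rfl, hor, k, rfl, H⟩
  let s : V → Bool := fun u => decide (u = G.endpt e false)
  let d : E → ℕ := fun e => (G.coboundary s e).toNat
  have hd : ∀ e, (d e).bodd = G.coboundary s e := by
    intro e; simp only [d]; cases G.coboundary s e <;> rfl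
  refine ⟨Γ', rfl, hor, fun e => k e + d e, ?_, Equivalent.trans ?_ H⟩
  · rw [Finset.sum_add_distrib, pow_add, neg_one_pow_sum_eq_stateSign htri s d hd,
      stateSign_single]
    ring
  · refine Equivalent.symm ((equivalent_flip_loop htri _ he).trans
      (Equivalent.of_switch s (fun h => ?_) fun e' => ?_))
    · rw [flip_flip]
      simp [flip_rot, s]
      rfl
    · simp only [insertHalfTwists, flip, Nat.bodd_add, hd, Bool.xor_assoc]

theorem parityClasses_neg_of_loop [Fintype V] [DecidableEq V] (htri : G.IsTrivalent)
    (Γ : RibbonGraph G) {e : E} (he : G.endpt e false = G.endpt e true) (ε : ℤ) :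
    Γ.parityClasses (-ε) = Γ.parityClasses ε := by
  refine Set.Subset.antisymm ?_ (parityClasses_subset_of_loop htri Γ he ε)
  simpa using parityClasses_subset_of_loop htri Γ he (-ε)

theorem signedColorings_eq_zero_of_loop [Fintype V] [DecidableEq V] (htri : G.IsTrivalent)
    (Γ : RibbonGraph G) {e : E} (he : G.endpt e false = G.endpt e true) (n : ℕ) :
    Γ.signedColorings n = 0 := by
  refine sum_eq_zero_of_xor_single_neg (G.endpt e false)
    (fun ν => ((Γ.flip ν).numPartialFaceColorings n : ℤ)) fun ν => ?_
  have := numPartialFaceColorings_congr (equivalent_flip_loop htri (Γ.flip ν) he) n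
  rw [flip_flip] at this
  rw [this]

/-- Half-twists leading from an oriented ribbon graph to `Γ` have the parities of a coboundary: that
of the switched discs `s` plus the difference `t` of the twists. The state is `s + t`. -/
theorem parityClasses_eq_image [Fintype V] (htri : G.IsTrivalent)
    (haut : G.HasTrivialAutomorphismGroup) (hloop : ∀ e, G.endpt e false ≠ G.endpt e true)
    {Γ : RibbonGraph G} (hor : Γ.IsOrientable) (ε : ℤ) :
    Γ.parityClasses ε =
      (fun ν => (⟦Γ.flip ν⟧ : Quotient (setoid G))) '' {ν | stateSign ν = ε} := by
  ext c
  constructor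
  · rintro ⟨Γ', rfl, hor', k, rfl, φ, α, s, h1, h2, h3, h4, h5⟩
    obtain ⟨rfl, rfl⟩ := haut.eq_one hloop h1 h2
    obtain ⟨hr, ht⟩ := switch_of_equivalent_one h3 h4 h5
    obtain ⟨t, ht'⟩ := hor'.exists_coboundary hor
    have hk : ∀ e, (k e).bodd = G.coboundary (fun v => s v ^^ t v) e := by
      intro e
      have h6 := ht e
      rw [ht' e] at h6
      rw [coboundary_xor]
      simp only [insertHalfTwists] at h6
      generalize Γ'.twist e = a at h6
      generalize G.coboundary t e = b at h6
      generalize G.coboundary s e = c at h6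
      generalize (k e).bodd = d at h6
      revert h6
      revert a b c d
      decide
    exact ⟨fun v => s v ^^ t v, (neg_one_pow_sum_eq_stateSign htri _ k hk).symm,
      Quotient.sound (Equivalent.symm (equivalent_flip_of_switch hr ht'))⟩
  · rintro ⟨ν, rfl, rfl⟩
    have hd : ∀ e, (G.coboundary ν e).toNat.bodd = G.coboundary ν e := by
      intro e; cases G.coboundary ν e <;> rfl
    -- One half-twist on each edge of the coboundary of `ν`; switching the discs in `ν` then removes
    -- them and restores the orders.
    refine ⟨Γ.flip ν, rfl, hor, fun e => (G.coboundary ν e).toNat,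
      neg_one_pow_sum_eq_stateSign htri ν _ hd, Equivalent.of_switch ν (fun h => ?_) fun e => ?_⟩
    · have h1 : Γ.rot h = ((Γ.flip ν).flip ν).rot h := by
        rw [flip_flip]; simp [flip_rot]
      exact h1
    · simp [insertHalfTwists, flip, hd]

theorem flip_equivalent_flip_iff (hconn : G.IsConnected) (htri : G.IsTrivalent)
    (haut : G.HasTrivialAutomorphismGroup) (hloop : ∀ e, G.endpt e false ≠ G.endpt e true)
    (Γ : RibbonGraph G) (ν μ : V → Bool) :
    (Γ.flip μ).Equivalent (Γ.flip ν) ↔ μ = ν ∨ μ = fun v => !ν v := by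
  constructor
  · rintro ⟨φ, α, s, h1, h2, h3, h4, h5⟩
    obtain ⟨rfl, rfl⟩ := haut.eq_one hloop h1 h2
    obtain ⟨hr, ht⟩ := switch_of_equivalent_one h3 h4 h5
    -- Both sides have the twists of `Γ`, so the set of switched discs has zero coboundary.
    have hs : ∀ u v, s u = s v := eq_of_isConnected hconn fun e => by
      have h6 := ht e
      simp only [flip] at h6
      generalize Γ.twist e = a at h6
      generalize G.coboundary s e = b at h6
      revert h6
      revert a b
      decide
    have hv : ∀ v, μ v = (ν v ^^ s v) := by
      intro v
      have hne : {h | G.vert h = v}.Nonempty :=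
        Set.nonempty_of_ncard_ne_zero (by rw [ncard_fiber htri]; omega)
      obtain ⟨h, rfl⟩ := hne
      have h6 := hr h
      -- The two cyclic orders at a trivalent vertex differ, so the order at a vertex determines the
      -- value of the state there.
      have h7 : Γ.rot⁻¹ h ≠ Γ.rot h := by
        rw [rot_inv_eq htri]; exact rot_ne htri Γ _
      rw [flip_flip, flip_rot, flip_rot] at h6
      generalize (ν (G.vert h) ^^ s (G.vert h)) = a at h6
      generalize μ (G.vert h) = b at h6
      cases a <;> cases b
      · rfl
      · exact absurd h6 h7
      · exact absurd h6.symm h7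
      · rfl
    obtain ⟨v₀⟩ := hconn.nonempty
    cases h0 : s v₀
    · left; funext v; rw [hv, hs v v₀, h0]; simp
    · right; funext v; rw [hv, hs v v₀, h0]; simp
  · rintro (rfl | rfl)
    · exact Equivalent.refl _
    · refine Equivalent.of_switch (fun _ => true) (fun h => ?_) fun e => ?_
      · rw [flip_flip]; simp
      · simp [flip, coboundary]

theorem two_mul_finsum_parityClasses [Fintype V] [DecidableEq V] (hconn : G.IsConnected)
    (htri : G.IsTrivalent)
    (haut : G.HasTrivialAutomorphismGroup) (hloop : ∀ e, G.endpt e false ≠ G.endpt e true)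
    {Γ : RibbonGraph G} (hor : Γ.IsOrientable) (ε : ℤ) (n : ℕ) :
    2 * ∑ᶠ c ∈ Γ.parityClasses ε, classColorings n c =
      ∑ ν with stateSign ν = ε, (Γ.flip ν).numPartialFaceColorings n := by
  classical
  let A : Finset (V → Bool) := {ν | stateSign ν = ε}
  let f : (V → Bool) → Quotient (setoid G) := fun ν => ⟦Γ.flip ν⟧
  have hA : Γ.parityClasses ε = ((A.image f : Finset _) : Set _) := by
    rw [parityClasses_eq_image htri haut hloop hor]
    simp [A, f]
  rw [hA, finsum_mem_coe_finset]
  change _ = ∑ ν ∈ A, classColorings n (f ν)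
  rw [Finset.sum_comp (classColorings n) f, Finset.mul_sum]
  refine Finset.sum_congr rfl fun c hc => ?_
  obtain ⟨ν, hν, rfl⟩ := Finset.mem_image.mp hc
  have hfib : (A.filter fun μ => f μ = f ν) = {ν, fun v => !ν v} := by
    ext μ
    have hiff : f μ = f ν ↔ μ = ν ∨ μ = fun v => !ν v := by
      rw [← flip_equivalent_flip_iff hconn htri haut hloop Γ ν μ]
      exact Quotient.eq
    simp only [Finset.mem_filter, hiff, Finset.mem_insert, Finset.mem_singleton,
      and_iff_right_iff_imp]
    have hν' : stateSign ν = ε := by simpa [A] using hν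
    rintro (rfl | rfl)
    · exact hν
    · simpa [A, stateSign_not htri] using hν'
  obtain ⟨v₀⟩ := hconn.nonempty
  -- The fiber has two distinct elements because there is a vertex.
  rw [hfib, Finset.card_pair, smul_eq_mul]
  intro h
  have := congrFun h v₀
  simp at this

end Classes

theorem signedColorings_eq_sub [Fintype V] [DecidableEq V] (Γ : RibbonGraph G) (n : ℕ) :
    Γ.signedColorings n =
      ((∑ ν with stateSign ν = 1, (Γ.flip ν).numPartialFaceColorings n : ℕ) : ℤ) -
      ((∑ ν with stateSign ν = -1, (Γ.flip ν).numPartialFaceColorings n : ℕ) : ℤ) := by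
  rw [signedColorings, Nat.cast_sum, Nat.cast_sum, Finset.sum_filter, Finset.sum_filter,
    ← Finset.sum_sub_distrib]
  refine Finset.sum_congr rfl fun ν _ => ?_
  rcases stateSign_eq_one_or ν with h | h <;> rw [h] <;> norm_num

end RibbonGraph

/-! ### The theorem, without and with loops -/

theorem theorem4 {V : Type*} {E : Type*} [Fintype V] [DecidableEq V] [Fintype E]
    (G : Multigraph V E) (hconn : G.IsConnected) (htri : G.IsTrivalent)
    (haut : G.HasTrivialAutomorphismGroup)
    (Γ : RibbonGraph G) (hor : Γ.IsOrientable) (hnonneg : Γ.IsNonnegative) (n : ℕ) :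
    G.vertexPolynomial.eval (n : ℤ) =
      2 * ((Γ.evenColorings n : ℤ) - (Γ.oddColorings n : ℤ)) := by
  rw [RibbonGraph.eval_graph_vertexPolynomial htri hor hnonneg, RibbonGraph.evenColorings_eq,
    RibbonGraph.oddColorings_eq]
  by_cases hloop : ∀ e, G.endpt e false ≠ G.endpt e true
  · rw [RibbonGraph.signedColorings_eq_sub,
      ← RibbonGraph.two_mul_finsum_parityClasses hconn htri haut hloop hor,
      ← RibbonGraph.two_mul_finsum_parityClasses hconn htri haut hloop hor]
    push_cast
    ring
  · push Not at hloop
    obtain ⟨e, he⟩ := hloop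
    rw [RibbonGraph.signedColorings_eq_zero_of_loop htri Γ he,
      RibbonGraph.parityClasses_neg_of_loop htri Γ he]
    ring
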